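/- There is a universal constant $C>0$ such that the following holds. Let $d\ge 1$ be an integer, let $B_d=\{x\in\mathbb{R}^d:\|x\|\le 1\}$ be the closed Euclidean unit ball, and let $f$ be a radial function on $B_d$, i.e. $f(x)=\varphi(\|x\|)$ for all $x\in B_d$ and some univariate function $\varphi$, such that $f$ is $1$-Lipschitz on $B_d$ with respect to the Euclidean norm. Then for every $\varepsilon>0$ there exist an integer $n\ge 0$ with $$n\le \exp\bigl(C\,d\,\log(1/\varepsilon)\bigr)=(1/\varepsilon)^{Cd}$$ and a depth-$2$ ReLU network of width $n$, $$N(x)=\sum_{i=1}^{n} v_i\max\{0,\langle w_i,x\rangle+b_i\}+b_0,\qquad w_i\in\mathbb{R}^d,\ v_i,b_i,b_0\in\mathbb{R},$$ such that $$\sup_{x\in B_d}|f(x)-N(x)|<\varepsilon.$$ (For $n=0$ the network is the constant $b_0$.) -/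

import Mathlib

/-- The ReLU activation function `z ↦ max {0, z}`. -/
noncomputable def relu (z : ℝ) : ℝ := max 0 z

/-- A depth-2 ReLU network of width `n` on `ℝ^d`: `n` hidden neurons with weights `w i ∈ ℝ^d` and
biases `b i`, output weights `v i` and an output bias `b₀`. All parameters are arbitrary reals. -/
structure DepthTwoReLUNetwork (d n : ℕ) where
  /-- Weight vectors of the hidden neurons. -/
  w : Fin n → EuclideanSpace ℝ (Fin d)
  /-- Biases of the hidden neurons. -/
  b : Fin n → ℝ
  /-- Weights of the output neuron. -/
  v : Fin n → ℝ
  /-- Bias of the output neuron. -/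
  b₀ : ℝ

/-- The function `x ↦ ∑ i, v i * relu (⟨w i, x⟩ + b i) + b₀` computed by the network. -/
noncomputable def DepthTwoReLUNetwork.eval {d n : ℕ} (N : DepthTwoReLUNetwork d n)
    (x : EuclideanSpace ℝ (Fin d)) : ℝ :=
  ∑ i, N.v i * relu (inner ℝ (N.w i) x + N.b i) + N.b₀

/-- The closed Euclidean unit ball of `ℝ^d`. -/
def unitBall (d : ℕ) : Set (EuclideanSpace ℝ (Fin d)) := Metric.closedBall 0 1

/-- `f` is radial on the unit ball: `f x = φ ‖x‖` there, for some univariate function `φ`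
(only the values of `φ` on `[0, 1]` matter). -/
def IsRadialOnUnitBall {d : ℕ} (f : EuclideanSpace ℝ (Fin d) → ℝ) : Prop :=
  ∃ φ : ℝ → ℝ, ∀ x ∈ unitBall d, f x = φ ‖x‖

/-! Write `f x = φ ‖x‖` and approximate `φ ∘ √` by a Bernstein polynomial `p` of degree `n`, a power
of `1/ε` (`abs_eval_bernsteinComb_sub_le`). For `w` uniform on the sphere, the average of `⟨w, x⟩ ^
(2k)` is `μ_k ‖x‖ ^ (2k)`, so `p (‖x‖²)` is the average of the ridge functions `q (⟨w, x⟩²)`, where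
`q` has the coefficients of `p` divided by `μ_k`.

The danger is the size of `q`: a bound exponential in `n` would ruin the width. In odd dimension `2m
+ 1`, however, `1/μ_k` is a product of `m` linear factors in `k` (`sphereMoment_mul_prod`). Hence
`q` arises from `p` by `m` operators `p ↦ p + c X p'`, each enlarging the Bernstein coefficients by
at most `1 + 4n` (`exists_bernsteinComb_coeff_mul`). Padding with zeros puts `ℝ^d` into dimension
`2d + 1`, so the Lipschitz constant of `q (t²)` is `n ^ O(d)`.

A positive cubature formula with `n ^ O(d)` nodes replaces the average exactly
(`exists_sphere_cubature`), and each ridge function is interpolated by ReLU ramps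
(`exists_relu_interpolation`). All factors of the width are `(1/ε) ^ O(d)`. -/

open MeasureTheory in
/-- The rotation invariant probability measure on the unit sphere of `ℝ^ι`, obtained by normalising
a uniformly distributed point of the unit ball. -/
noncomputable def sphereMeasure (ι : Type*) [Fintype ι] : Measure (EuclideanSpace ℝ ι) :=
  (ProbabilityTheory.cond volume (Metric.ball 0 1)).map (fun w => ‖w‖⁻¹ • w)

/-! ### Even moments of a coordinate on the sphere. -/

section Sphere

open MeasureTheory Metric

variable {ι : Type*} [Fintype ι]

theorem measurable_normalize :
    Measurable (fun w : EuclideanSpace ℝ ι => ‖w‖⁻¹ • w) := by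
  fun_prop

instance sphereMeasure.isProbabilityMeasure : IsProbabilityMeasure (sphereMeasure ι) := by
  have h : IsProbabilityMeasure
      (ProbabilityTheory.cond (volume : Measure (EuclideanSpace ℝ ι)) (ball 0 1)) :=
    ProbabilityTheory.cond_isProbabilityMeasure_of_finite (measure_ball_pos _ _ one_pos).ne'
      measure_ball_lt_top.ne
  exact Measure.isProbabilityMeasure_map measurable_normalize.aemeasurable

theorem ae_sphereMeasure_norm_eq_one [Nonempty ι] :
    ∀ᵐ w ∂(sphereMeasure ι), ‖w‖ = 1 := by
  rw [sphereMeasure, ae_map_iff measurable_normalize.aemeasurable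
    (measurableSet_eq_fun (by fun_prop) (by fun_prop))]
  refine ProbabilityTheory.cond_absolutelyContinuous.ae_le ?_
  have h : ∀ᵐ w ∂(volume : Measure (EuclideanSpace ℝ ι)), w ≠ 0 := by
    simp [ae_iff]
  filter_upwards [h] with w hw
  rw [norm_smul, norm_inv, norm_norm, inv_mul_cancel₀ (norm_ne_zero_iff.2 hw)]

theorem map_sphereMeasure (R : EuclideanSpace ℝ ι ≃ₗᵢ[ℝ] EuclideanSpace ℝ ι) :
    (sphereMeasure ι).map R = sphereMeasure ι := by
  have h1 : MeasurePreserving R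
      (ProbabilityTheory.cond volume (ball 0 1)) (ProbabilityTheory.cond volume (ball 0 1)) := by
    have := (R.measurePreserving.restrict_preimage
      (measurableSet_ball (x := (0 : EuclideanSpace ℝ ι)) (ε := 1)))
    have hpre : R ⁻¹' ball 0 1 = ball 0 1 := by
      ext w; simp
    rw [hpre] at this
    exact this.smul_measure _
  rw [sphereMeasure, Measure.map_map R.continuous.measurable measurable_normalize]
  conv_rhs => rw [← h1.map_eq, Measure.map_map measurable_normalize R.continuous.measurable]
  congr 1
  ext1 w
  simp

theorem integrable_sphereMeasure [Nonempty ι] {E : Type*} [NormedAddCommGroup E]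
    {F : EuclideanSpace ℝ ι → E}
    (hF : Continuous F) [SecondCountableTopology E] : Integrable F (sphereMeasure ι) := by
  obtain ⟨C, hC⟩ := (isCompact_closedBall (0 : EuclideanSpace ℝ ι) 1).exists_bound_of_continuousOn
    hF.continuousOn
  refine Integrable.of_bound hF.aestronglyMeasurable C ?_
  filter_upwards [ae_sphereMeasure_norm_eq_one] with w hw
  exact hC w (by simp [hw])

/-- The reflection exchanging `x` and `y` preserves the measure. Being a homeomorphism, it permits a
change of variables without measurability of `g`. -/
theorem integral_sphereMeasure_inner [Nonempty ι] (g : ℝ → ℝ) (x y : EuclideanSpace ℝ ι)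
    (h : ‖x‖ = ‖y‖) :
    ∫ w, g (inner ℝ w x) ∂(sphereMeasure ι) = ∫ w, g (inner ℝ w y) ∂(sphereMeasure ι) := by
  set R := (Submodule.span ℝ {x - y})ᗮ.reflection
  have hR : R x = y := Submodule.reflection_sub h
  conv_rhs => rw [← map_sphereMeasure R]
  have he : MeasurableEmbedding R := R.toHomeomorph.measurableEmbedding
  rw [he.integral_map]
  refine integral_congr_ae (.of_forall fun w => ?_)
  simp only [← hR, R.inner_map_map]

theorem integral_sphereMeasure_inner_pow [DecidableEq ι] (i₀ : ι) (k : ℕ)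
    (x : EuclideanSpace ℝ ι) :
    ∫ w, (inner ℝ w x) ^ (2 * k) ∂(sphereMeasure ι) =
      (‖x‖ ^ 2) ^ k * ∫ w, (w i₀) ^ (2 * k) ∂(sphereMeasure ι) := by
  have : Nonempty ι := ⟨i₀⟩
  rw [integral_sphereMeasure_inner (fun s => s ^ (2 * k)) x
    (‖x‖ • EuclideanSpace.single i₀ (1 : ℝ)) (by simp [norm_smul]), ← integral_const_mul]
  refine integral_congr_ae (.of_forall fun w => ?_)
  simp [inner_smul_right, EuclideanSpace.inner_single_right, mul_pow, pow_mul]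

/-- Rotation invariance in the direction `t e_i + e_{i₀}` gives a polynomial identity in `t` with
right side `c (t² + 1) ^ (k + 1)`; the coefficients of `t²` are compared. -/
theorem integral_sphereMeasure_pow_mul_sq [DecidableEq ι] {i₀ i : ι} (hi : i ≠ i₀) (k : ℕ) :
    (2 * k + 1) * ∫ w, (w i₀) ^ (2 * k) * (w i) ^ 2 ∂(sphereMeasure ι) =
      ∫ w, (w i₀) ^ (2 * (k + 1)) ∂(sphereMeasure ι) := by
  have : Nonempty ι := ⟨i₀⟩
  set c := ∫ w, (w i₀) ^ (2 * (k + 1)) ∂(sphereMeasure ι) with hc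
  set a : ℕ → ℝ := fun j => ∫ w, (w i) ^ j * (w i₀) ^ (2 * (k + 1) - j) ∂(sphereMeasure ι) with ha
  have hpoly : (∑ j ∈ Finset.range (2 * (k + 1) + 1),
        Polynomial.C (a j * (2 * (k + 1)).choose j) * Polynomial.X ^ j : Polynomial ℝ) =
      ∑ j ∈ Finset.range (k + 1 + 1),
        Polynomial.C (c * (k + 1).choose j) * Polynomial.X ^ (2 * j) := by
    refine Polynomial.funext fun t => ?_
    have h := integral_sphereMeasure_inner_pow i₀ (k + 1)
      (t • EuclideanSpace.single i (1 : ℝ) + EuclideanSpace.single i₀ (1 : ℝ))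
    have hn : ‖t • EuclideanSpace.single i (1 : ℝ) + EuclideanSpace.single i₀ (1 : ℝ)‖ ^ 2
        = t ^ 2 + 1 := by
      rw [norm_add_sq_real]
      simp [norm_smul, inner_smul_left, EuclideanSpace.inner_single_right, hi.symm]
    rw [hn, ← hc, add_pow] at h
    simp only [inner_add_right, inner_smul_right, EuclideanSpace.inner_single_right,
      Real.ringHom_apply, one_mul, add_pow (t * _)] at h
    rw [integral_finsetSum] at h
    · simp only [Polynomial.eval_finsetSum, Polynomial.eval_mul, Polynomial.eval_C,
        Polynomial.eval_pow, Polynomial.eval_X]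
      convert h using 1
      · refine Finset.sum_congr rfl fun j _ => ?_
        rw [ha]
        simp only [← integral_mul_const]
        refine integral_congr_ae (.of_forall fun w => ?_)
        simp only [mul_pow]
        ring
      · rw [Finset.sum_mul]
        refine Finset.sum_congr rfl fun j _ => ?_
        simp only [one_pow, pow_mul]
        ring
    · intro j _
      exact integrable_sphereMeasure (by fun_prop)
  have h2 := congrArg (fun p => Polynomial.coeff p 2) hpoly
  simp only [Polynomial.finsetSum_coeff, Polynomial.coeff_C_mul, Polynomial.coeff_X_pow] at h2
  rw [Finset.sum_eq_single 2 (by intro j _ hj; simp [hj.symm]) (by simp),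
    Finset.sum_eq_single 1 (by intro j _ hj; rw [if_neg (by omega)]; simp) (by simp)] at h2
  have hch : (((2 * (k + 1)).choose 2 : ℕ) : ℝ) = (k + 1) * (2 * k + 1) := by
    rw [Nat.cast_choose_two]; push_cast; ring
  have hk : (0 : ℝ) < k + 1 := by positivity
  have ha2 : a 2 = ∫ w, (w i₀) ^ (2 * k) * (w i) ^ 2 ∂(sphereMeasure ι) := by
    refine integral_congr_ae (.of_forall fun w => ?_)
    simp only [show 2 * (k + 1) - 2 = 2 * k by omega]
    ring
  rw [hch, ha2] at h2
  simp only [if_true, Nat.choose_one_right, mul_one] at h2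
  push_cast at h2
  refine mul_left_cancel₀ hk.ne' ?_
  linarith

/-- Insert `∑ i, w i ^ 2 = 1` into the moment of order `2k` and apply the mixed moment identity to
each `i ≠ i₀`. -/
theorem sphereMoment_succ [DecidableEq ι] (i₀ : ι) (k : ℕ) :
    (2 * k + Fintype.card ι) * ∫ w, (w i₀) ^ (2 * (k + 1)) ∂(sphereMeasure ι) =
      (2 * k + 1) * ∫ w, (w i₀) ^ (2 * k) ∂(sphereMeasure ι) := by
  have : Nonempty ι := ⟨i₀⟩
  have h : ∫ w, (w i₀) ^ (2 * k) ∂(sphereMeasure ι) =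
      ∑ i, ∫ w, (w i₀) ^ (2 * k) * (w i) ^ 2 ∂(sphereMeasure ι) := by
    rw [← integral_finsetSum _ fun i _ => integrable_sphereMeasure (by fun_prop)]
    refine integral_congr_ae ?_
    filter_upwards [ae_sphereMeasure_norm_eq_one] with w hw
    rw [← Finset.mul_sum, ← EuclideanSpace.real_norm_sq_eq, hw]
    simp
  rw [← Finset.add_sum_erase _ _ (Finset.mem_univ i₀)] at h
  have hsum : (2 * k + 1 : ℝ) * ∑ i ∈ Finset.univ.erase i₀,
      ∫ w, (w i₀) ^ (2 * k) * (w i) ^ 2 ∂(sphereMeasure ι) =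
      (Fintype.card ι - 1) * ∫ w, (w i₀) ^ (2 * (k + 1)) ∂(sphereMeasure ι) := by
    rw [Finset.mul_sum, Finset.sum_congr rfl fun i hi =>
      integral_sphereMeasure_pow_mul_sq (Finset.ne_of_mem_erase hi) k]
    simp [Finset.card_erase_of_mem, Nat.cast_sub Fintype.card_pos]
  have h0 : ∫ w, (w i₀) ^ (2 * k) * (w i₀) ^ 2 ∂(sphereMeasure ι) =
      ∫ w, (w i₀) ^ (2 * (k + 1)) ∂(sphereMeasure ι) := by
    refine integral_congr_ae (.of_forall fun w => ?_)
    simp only []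
    ring
  rw [h, h0, mul_add (2 * (k : ℝ) + 1), hsum]
  ring

/-- Odd dimension matters here: the moment recursion telescopes in steps of two, so the inverse
moment is a polynomial in `k` of degree `m`. -/
theorem sphereMoment_mul_prod [DecidableEq ι] (i₀ : ι) (m : ℕ) (hm : Fintype.card ι = 2 * m + 1)
    (k : ℕ) :
    (∫ w, (w i₀) ^ (2 * k) ∂(sphereMeasure ι)) *
      ∏ i ∈ Finset.range m, (1 + 2 / (2 * i + 1) * k : ℝ) = 1 := by
  have : Nonempty ι := ⟨i₀⟩
  induction k with
  | zero => simp
  | succ k ih =>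
    have hrec := sphereMoment_succ i₀ k
    have hprod : (2 * k + 1) * ∏ i ∈ Finset.range m, (1 + 2 / (2 * i + 1) * (k + 1 : ℕ) : ℝ) =
        (2 * k + 2 * m + 1) * ∏ i ∈ Finset.range m, (1 + 2 / (2 * i + 1) * k : ℝ) := by
      clear hm ih hrec
      induction m with
      | zero => simp
      | succ m ihm =>
        rw [Finset.prod_range_succ, Finset.prod_range_succ, ← mul_assoc, ihm]
        push_cast
        field_simp
        ring
    rw [hm] at hrec
    push_cast at hrec
    have hk : (0 : ℝ) < 2 * k + 2 * m + 1 := by positivity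
    refine mul_left_cancel₀ hk.ne' ?_
    rw [← mul_assoc, mul_one, add_assoc, hrec, mul_right_comm, hprod, mul_assoc,
      mul_comm (Finset.prod _ _), ih]
    ring

end Sphere

/-! ### Carathéodory's theorem and compactness of convex hulls. -/

section Caratheodory

open Module

variable {E : Type*} [NormedAddCommGroup E] [NormedSpace ℝ E] [FiniteDimensional ℝ E]

/-- Carathéodory's theorem with a fixed number of points. -/
theorem mem_convexHull_iff_exists_fin {s : Set E} {x : E} :
    x ∈ convexHull ℝ s ↔ ∃ (a : Fin (finrank ℝ E + 1) → ℝ) (z : Fin (finrank ℝ E + 1) → E),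
      a ∈ stdSimplex ℝ (Fin (finrank ℝ E + 1)) ∧ (∀ i, z i ∈ s) ∧ ∑ i, a i • z i = x := by
  constructor
  · intro hx
    obtain ⟨ι, _, z, w, hz, hind, hw, hw1, hsum⟩ := eq_pos_convex_span_of_mem_convexHull hx
    have hcard : Fintype.card ι ≤ Fintype.card (Fin (finrank ℝ E + 1)) := by
      rw [Fintype.card_fin]
      exact hind.card_le_finrank_succ.trans (Nat.add_le_add_right (Submodule.finrank_le _) 1)
    obtain ⟨e⟩ := Function.Embedding.nonempty_of_card_le hcard
    have hne : Nonempty ι := by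
      by_contra h
      rw [not_nonempty_iff] at h
      simp at hw1
    obtain ⟨i₀⟩ := hne
    -- Unused slots receive weight `0` and repeat the point `z i₀`.
    refine ⟨Function.extend e w 0, Function.extend e z fun _ => z i₀, ⟨fun i => ?_, ?_⟩,
      fun i => ?_, ?_⟩
    · by_cases h : ∃ j, e j = i
      · obtain ⟨j, rfl⟩ := h
        rw [e.injective.extend_apply]
        exact (hw j).le
      · rw [Function.extend_apply' _ _ _ h]
        simp
    · rw [← hw1]
      refine (Fintype.sum_of_injective e e.injective _ _ (fun i hi => ?_) fun i => ?_).symm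
      · rw [Function.extend_apply' _ _ _ (by simpa using hi)]
        simp
      · rw [e.injective.extend_apply]
    · by_cases h : ∃ j, e j = i
      · obtain ⟨j, rfl⟩ := h
        rw [e.injective.extend_apply]
        exact hz ⟨j, rfl⟩
      · rw [Function.extend_apply' _ _ _ h]
        exact hz ⟨i₀, rfl⟩
    · rw [← hsum]
      refine (Fintype.sum_of_injective e e.injective _ _ (fun i hi => ?_) fun i => ?_).symm
      · rw [Function.extend_apply' w _ _ (by simpa using hi)]
        simp
      · rw [e.injective.extend_apply, e.injective.extend_apply]
  · rintro ⟨a, z, ha, hz, rfl⟩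
    exact (convex_convexHull ℝ s).sum_mem (fun i _ => ha.1 i) ha.2
      fun i _ => subset_convexHull ℝ s (hz i)

theorem IsCompact.convexHull_of_finiteDimensional {s : Set E} (hs : IsCompact s) :
    IsCompact (convexHull ℝ s) := by
  have h : convexHull ℝ s = (fun p : (Fin (finrank ℝ E + 1) → ℝ) × (Fin (finrank ℝ E + 1) → E) =>
      ∑ i, p.1 i • p.2 i) ''
      (stdSimplex ℝ (Fin (finrank ℝ E + 1)) ×ˢ Set.univ.pi fun _ => s) := by
    ext x
    rw [mem_convexHull_iff_exists_fin]
    constructor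
    · rintro ⟨a, z, ha, hz, h⟩
      exact ⟨(a, z), ⟨ha, fun i _ => hz i⟩, h⟩
    · rintro ⟨⟨a, z⟩, ⟨ha, hz⟩, h⟩
      exact ⟨a, z, ha, fun i => hz i trivial, h⟩
  rw [h]
  exact ((isCompact_stdSimplex ℝ _).prod (isCompact_univ_pi fun _ => hs)).image (by fun_prop)

end Caratheodory

/-! ### Positive cubature on the sphere. -/

section Cubature

open MeasureTheory

variable {ι : Type*} [Fintype ι]

/-- All monomials in the coordinates of `w` whose exponents are at most `n`. -/
noncomputable def monomialVector (n : ℕ) (w : EuclideanSpace ℝ ι) : (ι → Fin (n + 1)) → ℝ :=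
  fun α => ∏ j, w j ^ (α j : ℕ)

theorem continuous_monomialVector (n : ℕ) :
    Continuous (monomialVector n : EuclideanSpace ℝ ι → _) := by
  unfold monomialVector
  fun_prop

/-- Multinomial theorem. Integrating the monomials exactly therefore integrates all ridge powers up
to `n` exactly. -/
theorem exists_inner_pow_eq_monomialVector [DecidableEq ι] (n k : ℕ) (hk : k ≤ n)
    (x : EuclideanSpace ℝ ι) :
    ∃ c : (ι → Fin (n + 1)) → ℝ, ∀ w : EuclideanSpace ℝ ι,
      (inner ℝ w x) ^ k = ∑ α, c α * monomialVector n w α := by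
  refine ⟨fun α => if ∑ j, (α j : ℕ) = k then
    Nat.multinomial Finset.univ (fun j => (α j : ℕ)) * ∏ j, x j ^ (α j : ℕ) else 0, fun w => ?_⟩
  have h : inner ℝ w x = ∑ j, w j * x j := by
    simp [PiLp.inner_apply, mul_comm]
  rw [h, Finset.sum_pow_eq_sum_piAntidiag]
  have hb : ∀ α ∈ Finset.piAntidiag (Finset.univ : Finset ι) k, ∀ j, α j < n + 1 := by
    intro α hα j
    rw [Finset.mem_piAntidiag] at hα
    have := Finset.single_le_sum (f := α) (fun _ _ => Nat.zero_le _) (Finset.mem_univ j)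
    have hsum : ∑ j, α j = k := hα.1
    omega
  simp only [ite_mul, zero_mul]
  rw [← Finset.sum_filter]
  refine Finset.sum_bij' (fun α hα j => ⟨α j, hb α hα j⟩) (fun β _ j => (β j : ℕ)) ?_ ?_ ?_ ?_ ?_
  · intro α hα
    rw [Finset.mem_piAntidiag] at hα
    simpa using hα.1
  · intro β hβ
    rw [Finset.mem_filter] at hβ
    rw [Finset.mem_piAntidiag]
    exact ⟨hβ.2, fun j _ => Finset.mem_univ j⟩
  · intro α hα
    rfl
  · intro β hβ
    rfl
  · intro α hα
    simp only [monomialVector, mul_pow, Finset.prod_mul_distrib]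
    ring

/-- A cubature formula on the sphere with positive weights, exact for ridge polynomials. -/
theorem exists_sphere_cubature [DecidableEq ι] [Nonempty ι] (n : ℕ) :
    ∃ (a : Fin ((n + 1) ^ Fintype.card ι + 1) → ℝ)
      (w : Fin ((n + 1) ^ Fintype.card ι + 1) → EuclideanSpace ℝ ι),
      (∀ i, 0 ≤ a i) ∧ ∑ i, a i = 1 ∧ (∀ i, ‖w i‖ = 1) ∧
      ∀ k ≤ n, ∀ x : EuclideanSpace ℝ ι,
        ∑ i, a i * (inner ℝ (w i) x) ^ k = ∫ w, (inner ℝ w x) ^ k ∂(sphereMeasure ι) := by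
  have hcont := continuous_monomialVector (ι := ι) n
  have hcomp : IsCompact (monomialVector n '' Metric.sphere (0 : EuclideanSpace ℝ ι) 1) :=
    (isCompact_sphere _ _).image hcont
  -- The barycentre of a probability measure lies in a closed convex set carrying it; Carathéodory
  -- then turns it into finitely many nodes.
  have hmem : ∫ w, monomialVector n w ∂(sphereMeasure ι) ∈
      convexHull ℝ (monomialVector n '' Metric.sphere (0 : EuclideanSpace ℝ ι) 1) := by
    refine (convex_convexHull ℝ _).integral_mem
      hcomp.convexHull_of_finiteDimensional.isClosed ?_ (integrable_sphereMeasure hcont)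
    filter_upwards [ae_sphereMeasure_norm_eq_one] with w hw
    exact subset_convexHull ℝ _ ⟨w, by simpa using hw, rfl⟩
  rw [mem_convexHull_iff_exists_fin] at hmem
  have hfin : Module.finrank ℝ ((ι → Fin (n + 1)) → ℝ) = (n + 1) ^ Fintype.card ι := by
    simp
  rw [hfin] at hmem
  obtain ⟨a, z, ha, hz, hsum⟩ := hmem
  choose w hw hwz using hz
  refine ⟨a, w, ha.1, ha.2, fun i => by simpa using hw i, fun k hk x => ?_⟩
  obtain ⟨c, hc⟩ := exists_inner_pow_eq_monomialVector n k hk x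
  simp only [hc]
  have hint : ∀ α, Integrable (fun w => monomialVector n w α) (sphereMeasure ι) := fun α =>
    integrable_sphereMeasure ((continuous_apply α).comp hcont)
  rw [integral_finsetSum _ fun α _ => (hint α).const_mul (c α)]
  simp only [Finset.mul_sum]
  rw [Finset.sum_comm]
  refine Finset.sum_congr rfl fun α _ => ?_
  have h := congrFun hsum α
  rw [eval_integral hint] at h
  rw [integral_const_mul, ← h]
  simp only [Finset.sum_apply, Pi.smul_apply, smul_eq_mul, ← hwz, Finset.mul_sum]
  exact Finset.sum_congr rfl fun i _ => by ring

end Cubature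

/-! ### Bernstein polynomials: derivatives, coefficient growth, approximation. -/

section Bernstein

open Polynomial

/-- The polynomial with coefficients `b 0, …, b n` in the Bernstein basis of degree `n`. -/
noncomputable def bernsteinComb (n : ℕ) (b : ℕ → ℝ) : ℝ[X] :=
  ∑ j ∈ Finset.range (n + 1), C (b j) * bernsteinPolynomial ℝ n j

theorem eval_bernsteinPolynomial_nonneg (n j : ℕ) {s : ℝ} (hs : s ∈ Set.Icc (0 : ℝ) 1) :
    0 ≤ (bernsteinPolynomial ℝ n j).eval s := by
  have h0 := hs.1
  have h1 : 0 ≤ 1 - s := by linarith [hs.2]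
  simp only [bernsteinPolynomial, eval_mul, eval_natCast, eval_pow, eval_X, eval_sub, eval_one]
  positivity

theorem sum_eval_bernsteinPolynomial (n : ℕ) (s : ℝ) :
    ∑ j ∈ Finset.range (n + 1), (bernsteinPolynomial ℝ n j).eval s = 1 := by
  rw [← eval_finsetSum, bernsteinPolynomial.sum, eval_one]

theorem eval_bernsteinPolynomial_le_one (n j : ℕ) {s : ℝ} (hs : s ∈ Set.Icc (0 : ℝ) 1) :
    (bernsteinPolynomial ℝ n j).eval s ≤ 1 := by
  rcases lt_or_ge n j with h | h
  · simp [bernsteinPolynomial.eq_zero_of_lt ℝ h]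
  · rw [← sum_eval_bernsteinPolynomial n s]
    exact Finset.single_le_sum (f := fun j => (bernsteinPolynomial ℝ n j).eval s)
      (fun i _ => eval_bernsteinPolynomial_nonneg n i hs) (Finset.mem_range.2 (by omega))

theorem abs_eval_derivative_bernsteinPolynomial_le (n j : ℕ) {s : ℝ}
    (hs : s ∈ Set.Icc (0 : ℝ) 1) :
    |(derivative (bernsteinPolynomial ℝ n j)).eval s| ≤ n := by
  have hn : (0 : ℝ) ≤ n := n.cast_nonneg
  cases j with
  | zero =>
    have h0 := eval_bernsteinPolynomial_nonneg (n - 1) 0 hs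
    have h1 := eval_bernsteinPolynomial_le_one (n - 1) 0 hs
    simp only [bernsteinPolynomial.derivative_zero, eval_mul, eval_neg, eval_natCast]
    rw [abs_mul, abs_neg, abs_of_nonneg hn, abs_of_nonneg h0]
    exact mul_le_of_le_one_right hn h1
  | succ j =>
    have h0 := eval_bernsteinPolynomial_nonneg (n - 1) j hs
    have h1 := eval_bernsteinPolynomial_le_one (n - 1) j hs
    have h0' := eval_bernsteinPolynomial_nonneg (n - 1) (j + 1) hs
    have h1' := eval_bernsteinPolynomial_le_one (n - 1) (j + 1) hs
    simp only [bernsteinPolynomial.derivative_succ, eval_mul, eval_sub, eval_natCast]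
    rw [abs_mul, abs_of_nonneg hn]
    exact mul_le_of_le_one_right hn (abs_le.2 ⟨by linarith, by linarith⟩)

theorem abs_eval_derivative_bernsteinComb_le (n : ℕ) (b : ℕ → ℝ) (A : ℝ)
    (hb : ∀ j ≤ n, |b j| ≤ A) {s : ℝ} (hs : s ∈ Set.Icc (0 : ℝ) 1) :
    |(derivative (bernsteinComb n b)).eval s| ≤ (n + 1) * (A * n) := by
  have hA : 0 ≤ A := (abs_nonneg _).trans (hb 0 n.zero_le)
  simp only [bernsteinComb, derivative_sum, eval_finsetSum, derivative_C_mul, eval_mul, eval_C]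
  refine (Finset.abs_sum_le_sum_abs _ _).trans ?_
  refine (Finset.sum_le_card_nsmul _ _ (A * n) fun j hj => ?_).trans ?_
  · rw [abs_mul]
    exact mul_le_mul (hb j (by simpa [Nat.lt_succ_iff] using hj))
      (abs_eval_derivative_bernsteinPolynomial_le n j hs) (abs_nonneg _) hA
  · simp

theorem natDegree_bernsteinComb_le (n : ℕ) (b : ℕ → ℝ) : (bernsteinComb n b).natDegree ≤ n := by
  refine natDegree_sum_le_of_forall_le _ _ fun j hj => ?_
  have hj' : j ≤ n := by simpa [Nat.lt_succ_iff] using hj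
  refine (natDegree_C_mul_le _ _).trans ?_
  unfold bernsteinPolynomial
  compute_degree
  omega

/-- Shows that `p ↦ X p'` is bidiagonal in the Bernstein basis, with entries of size at most `n`. -/
theorem X_mul_derivative_bernsteinPolynomial (n j : ℕ) :
    X * derivative (bernsteinPolynomial ℝ n j) =
      (j : ℝ[X]) * bernsteinPolynomial ℝ n j -
        ((j : ℝ[X]) + 1) * bernsteinPolynomial ℝ n (j + 1) := by
  have hch : ((n.choose (j + 1) : ℕ) : ℝ[X]) * ((j : ℝ[X]) + 1) =
      (n.choose j : ℕ) * ((n - j : ℕ) : ℝ[X]) := by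
    have := Nat.choose_succ_right_eq n j
    exact_mod_cast congrArg (fun k : ℕ => (k : ℝ[X])) this
  have hsub : n - (j + 1) = n - j - 1 := by omega
  have hX : X * ((j : ℝ[X]) * X ^ (j - 1)) = (j : ℝ[X]) * X ^ j := by
    cases j with
    | zero => simp
    | succ j => simp only [Nat.add_sub_cancel]; ring
  simp only [bernsteinPolynomial, derivative_mul, derivative_natCast, derivative_pow,
    derivative_sub, derivative_one, derivative_X, hsub, map_natCast]
  linear_combination (n.choose j : ℝ[X]) * (1 - X) ^ (n - j) * hX
    + X ^ (j + 1) * (1 - X) ^ (n - j - 1) * hch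

theorem X_mul_derivative_bernsteinComb (n : ℕ) (b : ℕ → ℝ) :
    X * derivative (bernsteinComb n b) = bernsteinComb n fun j => j * (b j - b (j - 1)) := by
  have h : ∀ j, C (b j) * (X * derivative (bernsteinPolynomial ℝ n j)) =
      C (j * b j) * bernsteinPolynomial ℝ n j -
        C (((j + 1 : ℕ) : ℝ) * b (j + 1 - 1)) * bernsteinPolynomial ℝ n (j + 1) := by
    intro j
    rw [X_mul_derivative_bernsteinPolynomial]
    simp only [Nat.add_sub_cancel, map_mul, map_natCast]
    push_cast
    ring
  simp only [bernsteinComb, derivative_sum, derivative_C_mul, Finset.mul_sum,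
    mul_left_comm X, h, Finset.sum_sub_distrib, mul_sub, map_sub, sub_mul]
  congr 1
  -- Index shift: the new top term vanishes since its index exceeds `n`, the bottom one by its
  -- factor `j = 0`.
  have h2 := Finset.sum_range_succ'
    (fun j => C ((j : ℝ) * b (j - 1)) * bernsteinPolynomial ℝ n j) (n + 1)
  rw [Finset.sum_range_succ, bernsteinPolynomial.eq_zero_of_lt ℝ (Nat.lt_succ_self n)] at h2
  simpa using h2.symm

/-- The operator `p ↦ p + c X p'` in the Bernstein basis. -/
theorem exists_bernsteinComb_coeff_mul (n : ℕ) (b : ℕ → ℝ) (A c : ℝ) (hc0 : 0 ≤ c) (hc2 : c ≤ 2)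
    (hb : ∀ j ≤ n, |b j| ≤ A) :
    ∃ b' : ℕ → ℝ, (∀ j ≤ n, |b' j| ≤ (1 + 4 * n) * A) ∧
      ∀ k, (bernsteinComb n b').coeff k = (1 + c * k) * (bernsteinComb n b).coeff k := by
  have hA : 0 ≤ A := (abs_nonneg _).trans (hb 0 n.zero_le)
  -- At `j = 0` the truncated `j - 1` is harmless because of the factor `j`.
  refine ⟨fun j => b j + c * (j * (b j - b (j - 1))), fun j hj => ?_, fun k => ?_⟩
  · have h1 := hb j hj
    have h2 := hb (j - 1) (by omega)
    have h3 : |b j - b (j - 1)| ≤ 2 * A := by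
      refine (abs_sub _ _).trans ?_
      linarith
    have hj' : (j : ℝ) ≤ n := by exact_mod_cast hj
    have h4 : |c * (j * (b j - b (j - 1)))| ≤ 2 * (n * (2 * A)) := by
      rw [abs_mul, abs_mul, abs_of_nonneg hc0, Nat.abs_cast]
      gcongr
    refine (abs_add_le _ _).trans ?_
    linarith
  · have h : bernsteinComb n (fun j => b j + c * (j * (b j - b (j - 1)))) =
        bernsteinComb n b + C c * (X * derivative (bernsteinComb n b)) := by
      rw [X_mul_derivative_bernsteinComb]
      simp only [bernsteinComb, Finset.mul_sum, ← Finset.sum_add_distrib]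
      refine Finset.sum_congr rfl fun j _ => ?_
      simp only [map_add, map_mul]
      ring
    rw [h, coeff_add, coeff_C_mul]
    cases k with
    | zero => simp
    | succ k =>
      rw [coeff_X_mul, coeff_derivative]
      push_cast
      ring

/-- Divides the coefficients by the sphere moments, one linear factor at a time; each `c = 2 / (2i +
1)` is at most `2`. -/
theorem exists_bernsteinComb_coeff_mul_prod (n m : ℕ) (b : ℕ → ℝ) (A : ℝ)
    (hb : ∀ j ≤ n, |b j| ≤ A) :
    ∃ b' : ℕ → ℝ, (∀ j ≤ n, |b' j| ≤ (1 + 4 * n) ^ m * A) ∧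
      ∀ k, (bernsteinComb n b').coeff k =
        (bernsteinComb n b).coeff k * ∏ i ∈ Finset.range m, (1 + 2 / (2 * i + 1) * k : ℝ) := by
  induction m with
  | zero => exact ⟨b, by simpa using hb, by simp⟩
  | succ m ih =>
    obtain ⟨b₁, hb₁, hcoeff⟩ := ih
    have hm : (0 : ℝ) ≤ m := m.cast_nonneg
    obtain ⟨b₂, hb₂, hcoeff₂⟩ := exists_bernsteinComb_coeff_mul n b₁ _ (2 / (2 * m + 1))
      (by positivity) (div_le_of_le_mul₀ (by positivity) (by norm_num) (by linarith)) hb₁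
    refine ⟨b₂, fun j hj => (hb₂ j hj).trans_eq (by ring), fun k => ?_⟩
    rw [hcoeff₂, hcoeff, Finset.prod_range_succ]
    ring

/-- Bernstein approximation of `φ ∘ √` for a Lipschitz function `φ`. -/
theorem abs_eval_bernsteinComb_sub_le (n : ℕ) (hn : n ≠ 0) (φ : ℝ → ℝ)
    (hφ : ∀ r ∈ Set.Icc (0 : ℝ) 1, ∀ t ∈ Set.Icc (0 : ℝ) 1, |φ r - φ t| ≤ |r - t|)
    (η : ℝ) (hη : 0 < η) {r : ℝ} (hr : r ∈ Set.Icc (0 : ℝ) 1) :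
    |(bernsteinComb n fun j => φ √(j / n)).eval (r ^ 2) - φ r| ≤ η + 1 / (4 * n * η ^ 3) := by
  have hn' : (0 : ℝ) < n := by positivity
  have hs : r ^ 2 ∈ Set.Icc (0 : ℝ) 1 := ⟨by positivity, pow_le_one₀ hr.1 hr.2⟩
  set s := r ^ 2 with hsdef
  have hvar : ∑ j ∈ Finset.range (n + 1),
      (s - j / n) ^ 2 * (bernsteinPolynomial ℝ n j).eval s = s * (1 - s) / n := by
    have h := congrArg (Polynomial.eval s) (bernsteinPolynomial.variance ℝ n)
    simp only [nsmul_eq_mul, eval_finsetSum, eval_mul, eval_pow, eval_sub, eval_natCast, eval_X,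
      eval_one] at h
    have h' : s * (1 - s) / n = (n * s * (1 - s)) / n ^ 2 := by field_simp
    rw [h', ← h, Finset.sum_div]
    refine Finset.sum_congr rfl fun j _ => ?_
    field_simp
  -- With `t = √(j/n)` and `u = |t - r| ≤ t + r`, one has `u² ≤ |t² - r²|`. Either `u ≤ η`, or `u ≤
  -- u⁴ / η³`, which the variance controls.
  have hpt : ∀ j ∈ Finset.range (n + 1),
      |φ √(j / n) - φ r| ≤ η + (s - j / n) ^ 2 / η ^ 3 := by
    intro j hj
    have hjn : (j : ℝ) ≤ n := by exact_mod_cast (by simpa [Nat.lt_succ_iff] using hj)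
    have hq : (j : ℝ) / n ∈ Set.Icc (0 : ℝ) 1 :=
      ⟨by positivity, div_le_one_of_le₀ hjn hn'.le⟩
    have hsq := Real.sq_sqrt hq.1
    have ht0 := Real.sqrt_nonneg ((j : ℝ) / n)
    have ht1 := Real.sqrt_le_one.2 hq.2
    set t := √((j : ℝ) / n) with ht
    refine (hφ t ⟨ht0, ht1⟩ r hr).trans ?_
    rw [← hsq, hsdef]
    have hu : |t - r| ^ 4 ≤ (r ^ 2 - t ^ 2) ^ 2 := by
      have h1 : |t - r| ≤ t + r := abs_le.2 ⟨by linarith [hr.1], by linarith [hr.1]⟩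
      have h2 : (t - r) ^ 2 ≤ (t + r) ^ 2 := by
        rw [← sq_abs (t - r)]
        exact pow_le_pow_left₀ (abs_nonneg _) h1 2
      calc |t - r| ^ 4 = (t - r) ^ 2 * (t - r) ^ 2 := by rw [← sq_abs (t - r)]; ring
        _ ≤ (t - r) ^ 2 * (t + r) ^ 2 := by gcongr
        _ = (r ^ 2 - t ^ 2) ^ 2 := by ring
    set u := |t - r|
    have hu0 : 0 ≤ u := abs_nonneg _
    rcases le_total u η with h | h
    · have : 0 ≤ (r ^ 2 - t ^ 2) ^ 2 / η ^ 3 := by positivity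
      linarith
    · have : u ≤ (r ^ 2 - t ^ 2) ^ 2 / η ^ 3 := by
        rw [le_div_iff₀ (by positivity)]
        calc u * η ^ 3 ≤ u * u ^ 3 := by gcongr
          _ = u ^ 4 := by ring
          _ ≤ _ := hu
      linarith
  have heval : (bernsteinComb n fun j => φ √(j / n)).eval s - φ r =
      ∑ j ∈ Finset.range (n + 1), (φ √(j / n) - φ r) * (bernsteinPolynomial ℝ n j).eval s := by
    simp only [sub_mul, Finset.sum_sub_distrib, ← Finset.mul_sum, sum_eval_bernsteinPolynomial,
      mul_one, bernsteinComb, eval_finsetSum, eval_mul, eval_C]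
  rw [heval]
  calc |∑ j ∈ Finset.range (n + 1), (φ √(j / n) - φ r) * (bernsteinPolynomial ℝ n j).eval s|
      ≤ ∑ j ∈ Finset.range (n + 1),
        (η + (s - j / n) ^ 2 / η ^ 3) * (bernsteinPolynomial ℝ n j).eval s := by
        refine (Finset.abs_sum_le_sum_abs _ _).trans (Finset.sum_le_sum fun j hj => ?_)
        have h0 := eval_bernsteinPolynomial_nonneg n j hs
        rw [abs_mul, abs_of_nonneg h0]
        exact mul_le_mul_of_nonneg_right (hpt j hj) h0
    _ = η + (s * (1 - s) / n) / η ^ 3 := by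
        rw [← hvar, Finset.sum_div]
        simp only [add_mul, Finset.sum_add_distrib, ← Finset.mul_sum,
          sum_eval_bernsteinPolynomial, mul_one]
        congr 1
        exact Finset.sum_congr rfl fun j _ => by ring
    _ ≤ η + (1 / 4 / n) / η ^ 3 := by
        gcongr
        nlinarith [sq_nonneg (s - 1 / 2)]
    _ = η + 1 / (4 * n * η ^ 3) := by
        field_simp

end Bernstein

/-! ### Radial polynomials as averages of ridge polynomials. -/

section RidgeDecomposition

open Polynomial

/-- In odd dimension `2m + 1`, a radial polynomial given in the Bernstein basis is a convex
combination of `(2n+1)^(2m+1) + 1` copies of one ridge polynomial with controlled coefficients. -/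
theorem exists_ridge_decomposition {ι : Type*} [Fintype ι] [DecidableEq ι] (m n : ℕ)
    (hm : Fintype.card ι = 2 * m + 1) (b : ℕ → ℝ) (hb : ∀ j ≤ n, |b j| ≤ 1) :
    ∃ (a : Fin ((2 * n + 1) ^ (2 * m + 1) + 1) → ℝ)
      (w : Fin ((2 * n + 1) ^ (2 * m + 1) + 1) → EuclideanSpace ℝ ι) (b' : ℕ → ℝ),
      (∀ i, 0 ≤ a i) ∧ ∑ i, a i = 1 ∧ (∀ i, ‖w i‖ = 1) ∧
      (∀ j ≤ n, |b' j| ≤ (1 + 4 * n) ^ m) ∧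
      ∀ x, ∑ i, a i * (bernsteinComb n b').eval ((inner ℝ (w i) x) ^ 2) =
        (bernsteinComb n b).eval (‖x‖ ^ 2) := by
  have hpos : 0 < Fintype.card ι := by omega
  obtain ⟨i₀⟩ := Fintype.card_pos_iff.1 hpos
  have : Nonempty ι := ⟨i₀⟩
  obtain ⟨b', hb', hcoeff⟩ := exists_bernsteinComb_coeff_mul_prod n m b 1 hb
  have hc := exists_sphere_cubature (ι := ι) (2 * n)
  rw [hm] at hc
  obtain ⟨a, w, ha, ha1, hw, hcub⟩ := hc
  refine ⟨a, w, b', ha, ha1, hw, by simpa using hb', fun x => ?_⟩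
  have hdeg : ∀ b, (bernsteinComb n b).natDegree < n + 1 := fun b =>
    Nat.lt_succ_of_le (natDegree_bernsteinComb_le n b)
  rw [eval_eq_sum_range' (hdeg b)]
  simp only [eval_eq_sum_range' (hdeg b'), Finset.mul_sum]
  rw [Finset.sum_comm]
  refine Finset.sum_congr rfl fun k hk => ?_
  have hk' : k ≤ n := Nat.lt_succ_iff.1 (Finset.mem_range.1 hk)
  -- Cubature of degree `2n` covers `⟨w, x⟩ ^ (2k)` for every `k ≤ n`; the moment it produces
  -- cancels the product built into `b'`.
  have h := hcub (2 * k) (by omega) x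
  rw [integral_sphereMeasure_inner_pow i₀] at h
  calc ∑ i, a i * ((bernsteinComb n b').coeff k * (inner ℝ (w i) x ^ 2) ^ k)
      = (bernsteinComb n b').coeff k * ∑ i, a i * inner ℝ (w i) x ^ (2 * k) := by
        rw [Finset.mul_sum]
        exact Finset.sum_congr rfl fun i _ => by rw [pow_mul]; ring
    _ = (bernsteinComb n b).coeff k * (‖x‖ ^ 2) ^ k * ((∫ w, (w i₀) ^ (2 * k) ∂(sphereMeasure ι)) *
          ∏ i ∈ Finset.range m, (1 + 2 / (2 * i + 1) * k : ℝ)) := by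
        rw [h, hcoeff]
        ring
    _ = _ := by rw [sphereMoment_mul_prod i₀ m hm k, mul_one]

end RidgeDecomposition

theorem abs_eval_sq_bernsteinComb_sub_le (n : ℕ) (b : ℕ → ℝ) (A : ℝ)
    (hb : ∀ j ≤ n, |b j| ≤ A) {t t' : ℝ} (ht : t ∈ Set.Icc (-1 : ℝ) 1)
    (ht' : t' ∈ Set.Icc (-1 : ℝ) 1) :
    |(bernsteinComb n b).eval (t ^ 2) - (bernsteinComb n b).eval (t' ^ 2)| ≤
      2 * ((n + 1) * (A * n)) * |t - t'| := by
  have hA : 0 ≤ A := (abs_nonneg _).trans (hb 0 n.zero_le)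
  have hmem : ∀ {t : ℝ}, t ∈ Set.Icc (-1 : ℝ) 1 → t ^ 2 ∈ Set.Icc (0 : ℝ) 1 := fun h =>
    ⟨by positivity, (sq_le_one_iff_abs_le_one _).2 (abs_le.2 h)⟩
  have h := (convex_Icc (0 : ℝ) 1).norm_image_sub_le_of_norm_hasDerivWithin_le
    (f := fun s => (bernsteinComb n b).eval s)
    (fun s _ => ((bernsteinComb n b).hasDerivAt s).hasDerivWithinAt)
    (fun s hs => abs_eval_derivative_bernsteinComb_le n b A hb hs) (hmem ht') (hmem ht)
  simp only [Real.norm_eq_abs] at h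
  refine h.trans ?_
  have h2 : |t ^ 2 - t' ^ 2| ≤ 2 * |t - t'| := by
    rw [sq_sub_sq, abs_mul]
    refine mul_le_mul_of_nonneg_right (abs_le.2 ⟨?_, ?_⟩) (abs_nonneg _)
    · linarith [ht.1, ht'.1]
    · linarith [ht.2, ht'.2]
  calc (n + 1) * (A * n) * |t ^ 2 - t' ^ 2| ≤ (n + 1) * (A * n) * (2 * |t - t'|) := by gcongr
    _ = _ := by ring

/-! ### From ridge functions to ReLU networks. -/

section ReLU

/-- Piecewise linear interpolation of a Lipschitz function on `[-1, 1]` by ReLU units. -/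
theorem exists_relu_interpolation (h : ℝ → ℝ) (L : ℝ)
    (hL : ∀ t ∈ Set.Icc (-1 : ℝ) 1, ∀ t' ∈ Set.Icc (-1 : ℝ) 1, |h t - h t'| ≤ L * |t - t'|)
    (K : ℕ) (hK : 0 < K) :
    ∃ (σ p q : Fin K → ℝ), ∀ t ∈ Set.Icc (-1 : ℝ) 1,
      |h t - (∑ i, σ i * (relu (t + p i) - relu (t + q i)) + h (-1))| ≤ 4 * L / K := by
  have hK' : (0 : ℝ) < K := by exact_mod_cast hK
  set τ : ℕ → ℝ := fun i => -1 + 2 * i / K with hτ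
  have hstep : ∀ i, τ (i + 1) = τ i + 2 / K := fun i => by
    simp only [hτ]; push_cast; ring
  have hδ : (0 : ℝ) < 2 / K := by positivity
  have hmono : Monotone τ := monotone_nat_of_le_succ fun i => by rw [hstep]; linarith
  have hτ0 : τ 0 = -1 := by simp [hτ]
  have hτK : τ K = 1 := by simp only [hτ]; field_simp; norm_num
  have hmem : ∀ i ≤ K, τ i ∈ Set.Icc (-1 : ℝ) 1 := fun i hi =>
    ⟨hτ0 ▸ hmono i.zero_le, hτK ▸ hmono hi⟩
  -- Each difference of two ReLUs is a ramp rising from `0` to `2 / K` between consecutive nodes, so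
  -- its weight is the slope of `h` there.
  refine ⟨fun i => (h (τ (i + 1)) - h (τ i)) / (2 / K), fun i => -τ i, fun i => -τ (i + 1),
    fun t ht => ?_⟩
  obtain ⟨j, hjK, hj1, hj2⟩ : ∃ j < K, τ j ≤ t ∧ t ≤ τ (j + 1) := by
    have hex : ∃ j, t ≤ τ (j + 1) := ⟨K, ht.2.trans (hτK ▸ hmono (Nat.le_succ K))⟩
    classical
    refine ⟨Nat.find hex, ?_, ?_, Nat.find_spec hex⟩
    · refine lt_of_le_of_lt (Nat.find_min' hex (m := K - 1) ?_) (by omega)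
      rw [Nat.sub_add_cancel hK, hτK]
      exact ht.2
    · rcases Nat.eq_zero_or_pos (Nat.find hex) with h0 | h0
      · rw [h0, hτ0]; exact ht.1
      · have := Nat.find_min hex (m := Nat.find hex - 1) (by omega)
        rw [Nat.sub_add_cancel h0] at this
        exact (not_le.1 this).le
  set F : ℕ → ℝ := fun i =>
    (h (τ (i + 1)) - h (τ i)) / (2 / K) * (relu (t + -τ i) - relu (t + -τ (i + 1))) with hF
  have hlow : ∀ i < j, F i = h (τ (i + 1)) - h (τ i) := by
    intro i hi
    have h1 : τ (i + 1) ≤ t := (hmono hi).trans hj1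
    have h2 : τ i ≤ t := (hmono (by omega)).trans hj1
    simp only [hF, relu]
    rw [max_eq_right (by linarith), max_eq_right (by linarith),
      show t + -τ i - (t + -τ (i + 1)) = 2 / K by rw [hstep]; ring, div_mul_cancel₀ _ hδ.ne']
  have hhigh : ∀ i, F (j + 1 + i) = 0 := by
    intro i
    have h1 : t ≤ τ (j + 1 + i) := hj2.trans (hmono (by omega))
    have h2 : t ≤ τ (j + 1 + i + 1) := hj2.trans (hmono (by omega))
    simp only [hF, relu]
    rw [max_eq_left (by linarith), max_eq_left (by linarith)]
    ring
  have hmid : F j = (h (τ (j + 1)) - h (τ j)) * ((t - τ j) / (2 / K)) := by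
    simp only [hF, relu]
    rw [max_eq_right (by linarith), max_eq_left (by linarith)]
    ring
  have hsum : ∑ i ∈ Finset.range K, F i = h (τ j) - h (-1) + F j := by
    obtain ⟨l, rfl⟩ := Nat.exists_eq_add_of_le (Nat.succ_le_of_lt hjK)
    rw [Nat.succ_eq_add_one, Finset.sum_range_add, Finset.sum_eq_zero fun i _ => hhigh i,
      Finset.sum_range_succ,
      Finset.sum_congr rfl fun i hi => hlow i (Finset.mem_range.1 hi),
      Finset.sum_range_sub (fun i => h (τ i)), hτ0, add_zero]
  rw [Fin.sum_univ_eq_sum_range F K, hsum, hmid]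
  have e1 := hL t ht (τ j) (hmem j hjK.le)
  have e2 := hL (τ (j + 1)) (hmem (j + 1) hjK) (τ j) (hmem j hjK.le)
  have hL0 : 0 ≤ L := by
    have := hL 1 (by norm_num) 0 (by norm_num)
    norm_num at this
    exact (abs_nonneg _).trans this
  have d1 : |t - τ j| ≤ 2 / K := by
    rw [abs_of_nonneg (by linarith)]
    linarith [hstep j]
  have d2 : |τ (j + 1) - τ j| = 2 / K := by
    rw [hstep, add_sub_cancel_left, abs_of_pos hδ]
  have d3 : |(t - τ j) / (2 / K)| ≤ 1 := by
    rw [abs_div, abs_of_pos hδ]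
    exact div_le_one_of_le₀ d1 hδ.le
  rw [d2] at e2
  have e3 : |(h (τ (j + 1)) - h (τ j)) * ((t - τ j) / (2 / K))| ≤ L * (2 / K) := by
    rw [abs_mul]
    exact (mul_le_of_le_one_right (abs_nonneg _) d3).trans e2
  calc _ = |(h t - h (τ j)) - (h (τ (j + 1)) - h (τ j)) * ((t - τ j) / (2 / K))| := by
        congr 1; ring
    _ ≤ L * (2 / K) + L * (2 / K) := (abs_sub _ _).trans
        (add_le_add (e1.trans (by gcongr)) e3)
    _ = 4 * L / K := by ring

/-- A depth-2 network whose neurons are indexed by an arbitrary finite type. -/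
theorem DepthTwoReLUNetwork.exists_eval_eq {d n : ℕ} {T : Type*} [Fintype T]
    (hn : Fintype.card T = n) (w : T → EuclideanSpace ℝ (Fin d)) (b v : T → ℝ) (b₀ : ℝ) :
    ∃ N : DepthTwoReLUNetwork d n,
      ∀ x, N.eval x = ∑ i, v i * relu (inner ℝ (w i) x + b i) + b₀ := by
  let e := (Fintype.equivFinOfCardEq hn).symm
  refine ⟨⟨w ∘ e, b ∘ e, v ∘ e, b₀⟩, fun x => ?_⟩
  simp only [DepthTwoReLUNetwork.eval, Function.comp_apply]
  rw [e.sum_comp fun i => v i * relu (inner ℝ (w i) x + b i)]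

theorem norm_toLp_sumElim_zero {ι κ : Type*} [Fintype ι] [Fintype κ] (x : EuclideanSpace ℝ ι) :
    ‖(WithLp.toLp 2 (Sum.elim x 0) : EuclideanSpace ℝ (ι ⊕ κ))‖ = ‖x‖ := by
  simp [EuclideanSpace.norm_eq]

/-- A convex combination of copies of one Lipschitz ridge function in unit directions of a larger
Euclidean space is close to a depth-2 network. -/
theorem exists_network_of_ridge {d : ℕ} {κ : Type*} [Fintype κ] (M K : ℕ) (hK : 0 < K)
    (a : Fin M → ℝ) (w : Fin M → EuclideanSpace ℝ (Fin d ⊕ κ)) (ha : ∀ i, 0 ≤ a i)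
    (ha1 : ∑ i, a i = 1) (hw : ∀ i, ‖w i‖ = 1) (h : ℝ → ℝ) (L : ℝ)
    (hL : ∀ t ∈ Set.Icc (-1 : ℝ) 1, ∀ t' ∈ Set.Icc (-1 : ℝ) 1, |h t - h t'| ≤ L * |t - t'|)
    (c : ℝ) :
    ∃ N : DepthTwoReLUNetwork d (2 * (M * K)), ∀ x ∈ unitBall d,
      |∑ i, a i * h (inner ℝ (w i) (WithLp.toLp 2 (Sum.elim x 0))) + c - N.eval x| ≤
        4 * L / K := by
  obtain ⟨σ, p, q, hσ⟩ := exists_relu_interpolation h L hL K hK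
  -- A padded input only sees the first `d` coordinates of a direction.
  let w' : Fin M → EuclideanSpace ℝ (Fin d) := fun i => WithLp.toLp 2 fun j => w i (Sum.inl j)
  have hinner : ∀ i (x : EuclideanSpace ℝ (Fin d)),
      inner ℝ (w i) (WithLp.toLp 2 (Sum.elim x 0)) = inner ℝ (w' i) x := by
    intro i x
    simp [PiLp.inner_apply, w']
  have hcard : Fintype.card ((Fin M × Fin K) ⊕ (Fin M × Fin K)) = 2 * (M * K) := by
    simp [two_mul]
  obtain ⟨N, hN⟩ := DepthTwoReLUNetwork.exists_eval_eq hcard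
    (Sum.elim (fun i => w' i.1) fun i => w' i.1) (Sum.elim (fun i => p i.2) fun i => q i.2)
    (Sum.elim (fun i => a i.1 * σ i.2) fun i => -(a i.1 * σ i.2)) (h (-1) + c)
  refine ⟨N, fun x hx => ?_⟩
  have hnet : N.eval x = ∑ i, a i * (∑ k, σ k *
      (relu (inner ℝ (w' i) x + p k) - relu (inner ℝ (w' i) x + q k)) + h (-1)) + c := by
    rw [hN, Fintype.sum_sum_type, Fintype.sum_prod_type, Fintype.sum_prod_type,
      ← Finset.sum_add_distrib]
    simp only [Sum.elim_inl, Sum.elim_inr, mul_add, Finset.sum_add_distrib, ← Finset.sum_mul, ha1,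
      one_mul, mul_sub, Finset.sum_sub_distrib, Finset.mul_sum, neg_mul, Finset.sum_neg_distrib,
      mul_assoc]
    ring
  have hmem : ∀ i, inner ℝ (w' i) x ∈ Set.Icc (-1 : ℝ) 1 := by
    intro i
    rw [← hinner, Set.mem_Icc, ← abs_le]
    refine (abs_real_inner_le_norm _ _).trans ?_
    have hJ : ‖(WithLp.toLp 2 (Sum.elim x 0) : EuclideanSpace ℝ (Fin d ⊕ κ))‖ = ‖x‖ :=
      norm_toLp_sumElim_zero x
    rw [hw, one_mul, hJ]
    simpa [unitBall] using hx
  rw [hnet, add_sub_add_right_eq_sub, ← Finset.sum_sub_distrib]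
  refine (Finset.abs_sum_le_sum_abs _ _).trans ?_
  -- Since the weights are convex, the error does not grow with the number `M` of directions.
  have hconst : 4 * L / K = ∑ i, a i * (4 * L / K) := by rw [← Finset.sum_mul, ha1, one_mul]
  rw [hconst]
  refine Finset.sum_le_sum fun i _ => ?_
  rw [hinner, ← mul_sub, abs_mul, abs_of_nonneg (ha i)]
  exact mul_le_mul_of_nonneg_left (hσ _ (hmem i)) (ha i)

end ReLU

/-! ### Choice of parameters and conclusion. -/

/-- The crude count behind the width bound, with `n = P ^ 12` and `K = 16 L P`. -/
theorem width_le_pow (P d : ℕ) (hP : 2 ≤ P) (hd : 1 ≤ d) :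
    2 * (((2 * P ^ 12 + 1) ^ (2 * d + 1) + 1) *
      (16 * (2 * ((P ^ 12 + 1) * ((1 + 4 * P ^ 12) ^ d * P ^ 12))) * P)) ≤ P ^ (91 * d) := by
  have h4 : 4 ≤ P ^ 2 := by nlinarith
  have h8 : 8 ≤ P ^ 3 := by rw [pow_succ]; nlinarith
  have h64 : 64 ≤ P ^ 6 := by rw [show 6 = 3 + 3 from rfl, pow_add]; nlinarith
  have hpos : ∀ k, 1 ≤ P ^ k := fun k => Nat.one_le_pow _ _ (by omega)
  have h1 : 2 * P ^ 12 + 1 ≤ P ^ 14 := by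
    rw [show 14 = 12 + 2 from rfl, pow_add P]; nlinarith [hpos 12]
  have h2 : P ^ 12 + 1 ≤ P ^ 13 := by
    rw [pow_succ P 12]; nlinarith [hpos 12]
  have h3 : 1 + 4 * P ^ 12 ≤ P ^ 15 := by
    rw [show 15 = 12 + 3 from rfl, pow_add P]; nlinarith [hpos 12]
  have h5 : (2 * P ^ 12 + 1) ^ (2 * d + 1) + 1 ≤ P ^ (28 * d + 15) := by
    have : (2 * P ^ 12 + 1) ^ (2 * d + 1) ≤ P ^ (28 * d + 14) := by
      calc _ ≤ (P ^ 14) ^ (2 * d + 1) := Nat.pow_le_pow_left h1 _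
        _ = _ := by rw [← pow_mul]; ring_nf
    rw [pow_succ P (28 * d + 14)]
    nlinarith [hpos (28 * d + 14)]
  have h6 : (1 + 4 * P ^ 12) ^ d ≤ P ^ (15 * d) := by
    rw [pow_mul]; exact Nat.pow_le_pow_left h3 _
  calc _ = 64 * (((2 * P ^ 12 + 1) ^ (2 * d + 1) + 1) * ((P ^ 12 + 1) *
        ((1 + 4 * P ^ 12) ^ d * P ^ 12) * P)) := by ring
    _ ≤ P ^ 6 * (P ^ (28 * d + 15) * (P ^ 13 * (P ^ (15 * d) * P ^ 12) * P)) := by gcongr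
    _ = P ^ (43 * d + 47) := by ring
    -- Here `1 ≤ d` absorbs the constant `47` into `48 d`.
    _ ≤ P ^ (91 * d) := Nat.pow_le_pow_right (by omega) (by omega)

/-- The profile of a radial Lipschitz function is Lipschitz. -/
theorem abs_profile_sub_le {d : ℕ} (hd : 1 ≤ d) {f : EuclideanSpace ℝ (Fin d) → ℝ} {φ : ℝ → ℝ}
    (hφ : ∀ x ∈ unitBall d, f x = φ ‖x‖) (hf : LipschitzOnWith 1 f (unitBall d)) :
    ∀ r ∈ Set.Icc (0 : ℝ) 1, ∀ t ∈ Set.Icc (0 : ℝ) 1, |φ r - φ t| ≤ |r - t| := by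
  intro r hr t ht
  -- Restrict `f` to a coordinate ray, where the norm is the parameter.
  let e : ℝ → EuclideanSpace ℝ (Fin d) := fun r => EuclideanSpace.single ⟨0, hd⟩ r
  have hnorm : ∀ r ∈ Set.Icc (0 : ℝ) 1, ‖e r‖ = r := fun r hr => by
    simp [e, abs_of_nonneg hr.1]
  have hmem : ∀ r ∈ Set.Icc (0 : ℝ) 1, e r ∈ unitBall d := fun r hr => by
    rw [unitBall, mem_closedBall_zero_iff, hnorm r hr]
    exact hr.2
  have h := hf.dist_le_mul (e r) (hmem r hr) (e t) (hmem t ht)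
  rw [hφ _ (hmem r hr), hφ _ (hmem t ht), hnorm r hr, hnorm t ht] at h
  simpa [e, Real.dist_eq] using h

/-- Three errors of at most `1 / (4P)` add up: the Bernstein cutoff `η = 1 / (4P)`, the variance
term, small because `n = P ^ 12`, and the interpolation error `4L / K` with `K = 16 L P`. -/
theorem exists_network_close {d : ℕ} (φ : ℝ → ℝ)
    (hφ : ∀ r ∈ Set.Icc (0 : ℝ) 1, ∀ t ∈ Set.Icc (0 : ℝ) 1, |φ r - φ t| ≤ |r - t|)
    (P : ℕ) (hP : 2 ≤ P) :
    ∃ N : DepthTwoReLUNetwork d (2 * (((2 * P ^ 12 + 1) ^ (2 * d + 1) + 1) *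
      (16 * (2 * ((P ^ 12 + 1) * ((1 + 4 * P ^ 12) ^ d * P ^ 12))) * P))),
      ∀ x ∈ unitBall d, |φ ‖x‖ - N.eval x| ≤ 3 / (4 * P) := by
  set n := P ^ 12 with hn
  have hP0 : 0 < P := by omega
  have hn0 : n ≠ 0 := by positivity
  have hP' : (0 : ℝ) < P := by exact_mod_cast hP0
  set L : ℕ := 2 * ((n + 1) * ((1 + 4 * n) ^ d * n)) with hLdef
  have hL0 : 0 < L := by positivity
  -- Subtracting `φ 0` bounds the Bernstein coefficients by `1`; the output bias restores it.
  set ψ : ℝ → ℝ := fun r => φ r - φ 0 with hψdef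
  have hψ : ∀ r ∈ Set.Icc (0 : ℝ) 1, ∀ t ∈ Set.Icc (0 : ℝ) 1, |ψ r - ψ t| ≤ |r - t| := by
    intro r hr t ht
    simpa [ψ] using hφ r hr t ht
  have hb : ∀ j ≤ n, |ψ √(j / n)| ≤ 1 := by
    intro j hj
    have hq : √((j : ℝ) / n) ≤ 1 := Real.sqrt_le_one.2
      (div_le_one_of_le₀ (by exact_mod_cast hj) n.cast_nonneg)
    refine (hφ _ ⟨Real.sqrt_nonneg _, hq⟩ 0 (by norm_num)).trans ?_
    rwa [sub_zero, abs_of_nonneg (Real.sqrt_nonneg _)]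
  obtain ⟨a, w, b', ha, ha1, hw, hb', hsum⟩ :=
    -- Padding by `d + 1` coordinates makes the dimension `2d + 1` odd, with `m = d`.
    exists_ridge_decomposition (ι := Fin d ⊕ Fin (d + 1)) d n (by simp; ring)
      (fun j => ψ √(j / n)) hb
  obtain ⟨N, hN⟩ := exists_network_of_ridge _ (16 * L * P) (by positivity) a w ha ha1 hw
    (fun t => (bernsteinComb n b').eval (t ^ 2)) L (fun t ht t' ht' => by
      have := abs_eval_sq_bernsteinComb_sub_le n b' _ hb' ht ht'
      rw [hLdef]
      push_cast
      exact this) (φ 0)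
  refine ⟨N, fun x hx => ?_⟩
  have hN' := hN x hx
  rw [hsum, norm_toLp_sumElim_zero] at hN'
  have hx1 : ‖x‖ ∈ Set.Icc (0 : ℝ) 1 := ⟨norm_nonneg _, by simpa [unitBall] using hx⟩
  have hB := abs_eval_bernsteinComb_sub_le n hn0 ψ hψ (1 / (4 * P)) (by positivity) hx1
  have hL' : (0 : ℝ) < L := by exact_mod_cast hL0
  have e1 : 4 * (L : ℝ) / ((16 * L * P : ℕ) : ℝ) = 1 / (4 * P) := by
    push_cast
    field_simp
    norm_num
  have e2 : 1 / (4 * (n : ℝ) * (1 / (4 * P)) ^ 3) ≤ 1 / (4 * P) := by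
    have h8 : (64 : ℝ) ≤ (P : ℝ) ^ 8 := by
      calc (64 : ℝ) ≤ 2 ^ 8 := by norm_num
        _ ≤ (P : ℝ) ^ 8 := by gcongr; exact_mod_cast hP
    rw [hn]
    push_cast
    refine one_div_le_one_div_of_le (by positivity) ?_
    have : 4 * (P : ℝ) ^ 12 * (1 / (4 * P)) ^ 3 = P * P ^ 8 / 16 := by
      field_simp
      norm_num
    rw [this]
    nlinarith
  rw [e1] at hN'
  have e3 : (3 : ℝ) / (4 * P) = 1 / (4 * P) + (1 / (4 * P) + 1 / (4 * P)) := by ring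
  rw [e3]
  have hsplit : φ ‖x‖ - N.eval x = ((bernsteinComb n fun j => ψ √(j / n)).eval (‖x‖ ^ 2) + φ 0 -
      N.eval x) - ((bernsteinComb n fun j => ψ √(j / n)).eval (‖x‖ ^ 2) - ψ ‖x‖) := by
    simp only [hψdef]
    ring
  rw [hsplit]
  exact (abs_sub _ _).trans (add_le_add hN' (hB.trans (by gcongr)))

/-- Boundedness is kept beside the supremum because the real `sSup` of an unbounded set is `0`. -/
theorem bddAbove_and_sSup_lt_of_forall_le {α : Type*} {s : Set α} (hs : s.Nonempty) {g : α → ℝ}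
    {δ ε : ℝ} (h : ∀ x ∈ s, g x ≤ δ) (hδ : δ < ε) :
    BddAbove (g '' s) ∧ sSup (g '' s) < ε := by
  have h' : ∀ y ∈ g '' s, y ≤ δ := by
    rintro _ ⟨x, hx, rfl⟩
    exact h x hx
  exact ⟨⟨δ, h'⟩, (csSup_le (hs.image g) h').trans_lt hδ⟩

theorem theorem3 :
    ∃ C : ℝ, 0 < C ∧
      ∀ (d : ℕ), 1 ≤ d →
      ∀ (f : EuclideanSpace ℝ (Fin d) → ℝ),
        IsRadialOnUnitBall f → LipschitzOnWith 1 f (unitBall d) →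
      ∀ (ε : ℝ), 0 < ε →
        ∃ (n : ℕ) (N : DepthTwoReLUNetwork d n),
          (n : ℝ) ≤ Real.exp (C * (d * Real.log (1 / ε))) ∧
          BddAbove ((fun x => |f x - N.eval x|) '' unitBall d) ∧
          sSup ((fun x => |f x - N.eval x|) '' unitBall d) < ε := by
  -- `182 = 2 * 91`: the width is at most `P ^ (91 d)` and `P ≤ (1/ε)²`.
  refine ⟨182, by norm_num, fun d hd f ⟨φ, hfφ⟩ hf ε hε => ?_⟩
  have hφ := abs_profile_sub_le hd hfφ hf
  have hne : (unitBall d).Nonempty := ⟨0, by simp [unitBall]⟩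
  -- For large `ε` the constant `φ (1/2)` suffices. Width `0` is forced once `ε > 1`, where the
  -- allowed bound is below `1`.
  rcases lt_or_ge (1 / 2) ε with hε2 | hε2
  · refine ⟨0, ⟨Fin.elim0, Fin.elim0, Fin.elim0, φ (1 / 2)⟩, by simp [Real.exp_nonneg], ?_⟩
    refine bddAbove_and_sSup_lt_of_forall_le hne (δ := 1 / 2) (fun x hx => ?_) hε2
    have hx1 : ‖x‖ ≤ 1 := by simpa [unitBall] using hx
    simp only [DepthTwoReLUNetwork.eval, Finset.univ_eq_empty, Finset.sum_empty, zero_add]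
    rw [hfφ x hx]
    refine (hφ _ ⟨norm_nonneg x, hx1⟩ _ (by norm_num)).trans (abs_le.2 ⟨?_, ?_⟩)
    · linarith [norm_nonneg x]
    · linarith
  · have hinv : 2 ≤ 1 / ε := by
      rw [le_div_iff₀ hε]
      linarith
    set P := ⌈1 / ε⌉₊ with hPdef
    have hP1 : 1 / ε ≤ P := Nat.le_ceil _
    have hP2 : 2 ≤ P := by exact_mod_cast hinv.trans hP1
    have hP0 : (0 : ℝ) < P := by linarith
    -- `y + 1 ≤ y²` for `y = 1/ε ≥ 2`.
    have hP3 : (P : ℝ) ≤ (1 / ε) ^ 2 := by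
      have := Nat.ceil_lt_add_one (a := 1 / ε) (by positivity)
      nlinarith
    obtain ⟨N, hN⟩ := exists_network_close (d := d) φ hφ P hP2
    refine ⟨_, N, ?_, ?_⟩
    · calc _ ≤ ((P ^ (91 * d) : ℕ) : ℝ) := by exact_mod_cast width_le_pow P d hP2 hd
        _ ≤ ((1 / ε) ^ 2) ^ (91 * d) := by
          push_cast
          gcongr
        _ = Real.exp (182 * (d * Real.log (1 / ε))) := by
          rw [← pow_mul, ← Real.exp_log (x := (1 / ε) ^ (2 * (91 * d))) (by positivity),
            Real.log_pow]
          push_cast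
          ring_nf
    · refine bddAbove_and_sSup_lt_of_forall_le hne (fun x hx => ?_) (δ := 3 / (4 * P)) ?_
      · simp only [hfφ x hx]
        exact hN x hx
      · rw [div_lt_iff₀ (by positivity)]
        rw [div_le_iff₀ hε] at hP1
        nlinarith
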